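/- We work over $\mathbb{C}$. By an irreducible curve we mean an integral scheme of dimension one that is proper (equivalently, projective) over $\mathbb{C}$; it may be singular unless it is said to be smooth. The degree of a dominant morphism $X\to Y$ of irreducible curves is the degree $[\mathbb{C}(X):\mathbb{C}(Y)]$ of the extension of function fields. Let $D$ be a smooth irreducible projective curve with a faithful action of a finite group $G$ by automorphisms over $\mathbb{C}$. Let $\alpha,\beta\in G$ have orders $o(\alpha)=d\ge 2$ and $o(\beta)=e\ge 2$, let $B=D/\langle\beta\rangle$ and $C=D/\langle\alpha\rangle$, and let $p:D\to B$ and $q:D\to C$ be the quotient morphisms, which have degrees $e$ and $d$ respectively. We say that the diagram $B\xleftarrow{\,p\,}D\xrightarrow{\,q\,}C$ completes if there are an irreducible curve $H$, a morphism $u:B\to H$ of degree $d$ and a morphism $v:C\to H$ of degree $e$ such that $u\circ p=v\circ q$. Then: 1. if $|\langle\alpha,\beta\rangle|=e\cdot d$, the diagram completes; 2. if $|\langle\alpha,\beta\rangle|>e\cdot d$, the diagram does not complete. -/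

import Mathlib

open CategoryTheory AlgebraicGeometry

/-- `Spec ℂ`. -/
noncomputable abbrev SpecC : Scheme.{0} := Spec (CommRingCat.of ℂ)

/-- An irreducible complex curve: an integral scheme of dimension one, proper over `ℂ`.
(In dimension one, proper over a field is the same as projective.) It may be singular. -/
structure IsComplexCurve (X : Over SpecC) : Prop where
  integral : IsIntegral X.left
  proper : IsProper X.hom
  dim_eq_one : topologicalKrullDim X.left = 1

/-- The morphism `f : X ⟶ Y` has degree `n`, written `(n:1)` on an arrow: `X` and `Y` are integral,
`f` is dominant, and the function field of `X` is an extension of degree `n` of the function field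
of `Y`. The extension is the stalk map of `f` at the generic point of `X`; its source is
the function field of `Y`, as a dominant `f` sends the generic point to the generic point. -/
def HasDegree {X Y : Scheme.{0}} (f : X ⟶ Y) (n : ℕ) : Prop :=
  ∃ (_ : IsIntegral X) (_ : IsIntegral Y) (_ : IsDominant f),
    letI : Algebra (Y.presheaf.stalk (f (genericPoint X))) (X.presheaf.stalk (genericPoint X)) :=
      (f.stalkMap (genericPoint X)).hom.toAlgebra
    Module.Finite (Y.presheaf.stalk (f (genericPoint X))) (X.presheaf.stalk (genericPoint X)) ∧
      Module.finrank (Y.presheaf.stalk (f (genericPoint X)))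
        (X.presheaf.stalk (genericPoint X)) = n

/-- `π : X ⟶ Y` is the quotient of `X` by the group `Γ` of automorphisms over `ℂ`, that is,
`Y = X / Γ`: `π` is `Γ`-invariant, `Y` carries the quotient topology, the fibres of `π` are
the orbits of `Γ`, and the structure sheaf of `Y` is the sheaf of `Γ`-invariants of `π_* 𝒪_X`. -/
structure IsQuotientByGroup {X Y : Over SpecC} (Γ : Subgroup (Aut X)) (π : X ⟶ Y) : Prop where
  invariant : ∀ γ ∈ Γ, γ.hom ≫ π = π
  isQuotientMap : Topology.IsQuotientMap π.left
  exists_of_eq : ∀ x y : X.left, π.left x = π.left y → ∃ γ ∈ Γ, γ.hom.left x = y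
  app_injective : ∀ U : Y.left.Opens, Function.Injective (π.left.app U).hom
  /-- A section `s` over `V = π⁻¹ U` that is invariant comes from `U`. Here `appLE V V h` is
  the pullback of sections along `γ`, and `h` always holds, as `V` is `Γ`-stable. -/
  mem_range_app : ∀ (U : Y.left.Opens) (s : Γ(X.left, π.left ⁻¹ᵁ U)),
    (∀ γ ∈ Γ, ∀ h : π.left ⁻¹ᵁ U ≤ γ.hom.left ⁻¹ᵁ (π.left ⁻¹ᵁ U),
      (γ.hom.left.appLE (π.left ⁻¹ᵁ U) (π.left ⁻¹ᵁ U) h).hom s = s) →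
    s ∈ Set.range (π.left.app U).hom

/-- The diagram `B ⟵ D ⟶ C`, given by `p : D ⟶ B` of degree `e` and `q : D ⟶ C` of degree `d`,
completes: there are a curve `H` and morphisms `u : B ⟶ H` of degree `d` and `v : C ⟶ H` of
degree `e` that make the square commute. -/
def DiagramCompletes {D B C : Over SpecC} (p : D ⟶ B) (q : D ⟶ C) (d e : ℕ) : Prop :=
  ∃ (H : Over SpecC) (u : B ⟶ H) (v : C ⟶ H),
    IsComplexCurve H ∧ HasDegree u.left d ∧ HasDegree v.left e ∧ p ≫ u = q ≫ v

/-!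
If the diagram completes to `H`, the function field `K(H)` lies in the field of invariants of
`⟨α, β⟩` acting on `K(D)`, and `[K(D) : K(H)] = e * d` bounds the number of automorphisms of `K(D)`
over `K(H)`; hence `|⟨α, β⟩| ≤ e * d`.

Conversely, if `|⟨α, β⟩| = e * d`, let `L` be the field of invariants of `⟨α, β⟩`, finitely
generated over `ℂ`, and let `H` be a proper model of `L`: the closure in a projective space of the
point whose coordinates generate `L`. The local rings of the smooth curve `D` are valuation rings,
hence so are those of its quotients `B` and `C`, and by the valuative criterion the inclusions of
`L = K(H)` in `K(B)` and `K(C)` come from morphisms `B ⟶ H` and `C ⟶ H`. Their degrees are given by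
Artin's theorem `[K(D) : K(D)^Γ] = |Γ|`. No group quotient `D / ⟨α, β⟩` has to be constructed.
-/

universe u

section FunctionFieldMap

variable {X Y Z : Scheme.{u}} [IsIntegral X] [IsIntegral Y] [IsIntegral Z]

theorem map_genericPoint_of_isDominant (f : X ⟶ Y) [IsDominant f] :
    f (genericPoint X) = genericPoint Y := by
  refine IsGenericPoint.eq ?_ (genericPoint_spec Y)
  have h := (genericPoint_spec X).image f.continuous
  rwa [Set.image_univ, f.denseRange.closure_range] at h

/-- The extension `K(Y) → K(X)` of function fields induced by a dominant morphism `f : X ⟶ Y`. The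
first factor identifies the stalks at the equal points `genericPoint Y` and `f (genericPoint X)`. -/
noncomputable def functionFieldMap (f : X ⟶ Y) [IsDominant f] : Y.functionField ⟶ X.functionField :=
  Y.presheaf.stalkSpecializes (specializes_of_eq (map_genericPoint_of_isDominant f)) ≫
    f.stalkMap (genericPoint X)

/-- The inclusion `Spec K(X) ⟶ X` of the generic point. -/
noncomputable abbrev fromSpecFunctionField (X : Scheme.{u}) [IrreducibleSpace X] :
    Spec X.functionField ⟶ X := X.fromSpecStalk (genericPoint X)

instance isDominant_fromSpecFunctionField (X : Scheme.{u}) [IrreducibleSpace X] :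
    IsDominant (fromSpecFunctionField X) := by
  refine ⟨(dense_iff_closure_eq.mpr (genericPoint_closure (α := X))).mono ?_⟩
  rw [Scheme.range_fromSpecStalk]
  exact Set.singleton_subset_iff.mpr specializes_rfl

theorem specMap_functionFieldMap (f : X ⟶ Y) [IsDominant f] :
    Spec.map (functionFieldMap f) ≫ fromSpecFunctionField Y = fromSpecFunctionField X ≫ f := by
  rw [functionFieldMap, Spec.map_comp, Category.assoc,
    Scheme.SpecMap_stalkSpecializes_fromSpecStalk, Scheme.SpecMap_stalkMap_fromSpecStalk]

theorem functionFieldMap_eq_iff (f : X ⟶ Y) [IsDominant f] (φ : Y.functionField ⟶ X.functionField) :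
    functionFieldMap f = φ ↔
      Spec.map φ ≫ fromSpecFunctionField Y = fromSpecFunctionField X ≫ f := by
  rw [← specMap_functionFieldMap, cancel_mono, Spec.map_inj, eq_comm]

theorem functionFieldMap_congr {f g : X ⟶ Y} [IsDominant f] [IsDominant g] (h : f = g) :
    functionFieldMap f = functionFieldMap g := by
  subst h; rfl

theorem functionFieldMap_id (X : Scheme.{u}) [IsIntegral X] : functionFieldMap (𝟙 X) = 𝟙 _ := by
  rw [functionFieldMap_eq_iff, Spec.map_id, Category.id_comp, Category.comp_id]

theorem functionFieldMap_comp (f : X ⟶ Y) (g : Y ⟶ Z) [IsDominant f] [IsDominant g] :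
    functionFieldMap (f ≫ g) = functionFieldMap g ≫ functionFieldMap f := by
  rw [functionFieldMap_eq_iff, Spec.map_comp, Category.assoc, specMap_functionFieldMap,
    reassoc_of% specMap_functionFieldMap f]

theorem functionFieldMap_comp_eq_id {f : X ⟶ Y} {g : Y ⟶ X} [IsDominant f] [IsDominant g]
    (h : f ≫ g = 𝟙 X) : functionFieldMap g ≫ functionFieldMap f = 𝟙 _ := by
  rw [← functionFieldMap_comp, functionFieldMap_congr h, functionFieldMap_id]

theorem functionFieldMap_germ (f : X ⟶ Y) [IsDominant f] (U : Y.Opens) (V : X.Opens)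
    (h : V ≤ f ⁻¹ᵁ U) (hU : genericPoint Y ∈ U) (hV : genericPoint X ∈ V) (s : Γ(Y, U)) :
    (functionFieldMap f).hom (Y.presheaf.germ U _ hU s) =
      X.presheaf.germ V _ hV ((f.appLE U V h).hom s) := by
  have hgerm : Y.presheaf.germ U _ hU ≫ functionFieldMap f =
      f.appLE U V h ≫ X.presheaf.germ V _ hV := by
    rw [functionFieldMap, ← Category.assoc, TopCat.Presheaf.germ_stalkSpecializes,
      Scheme.Hom.germ_stalkMap, Scheme.Hom.appLE, Category.assoc, TopCat.Presheaf.germ_res]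
  exact congr($hgerm s)

theorem functionFieldMap_algebraMap_stalk (f : X ⟶ Y) [IsDominant f] (x : X)
    (a : Y.presheaf.stalk (f x)) :
    (functionFieldMap f).hom (algebraMap (Y.presheaf.stalk (f x)) Y.functionField a) =
      algebraMap (X.presheaf.stalk x) X.functionField (f.stalkMap x a) := by
  have h : Y.presheaf.stalkSpecializes (genericPoint_specializes (f x)) ≫ functionFieldMap f =
      f.stalkMap x ≫ X.presheaf.stalkSpecializes (genericPoint_specializes x) := by
    rw [functionFieldMap, TopCat.Presheaf.stalkSpecializes_comp_assoc,
      Scheme.Hom.stalkSpecializes_stalkMap]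
  exact congr($h a)

theorem eq_of_fromSpecFunctionField_comp_eq {X Y S : Scheme.{u}} [IsIntegral X] {f g : X ⟶ Y}
    (s : Y ⟶ S) [IsSeparated s] (hs : f ≫ s = g ≫ s)
    (h : fromSpecFunctionField X ≫ f = fromSpecFunctionField X ≫ g) : f = g :=
  ext_of_isDominant_of_isSeparated s hs (fromSpecFunctionField X) h

theorem eq_of_functionFieldMap_eq {S : Scheme.{u}} {f g : X ⟶ Y} [IsDominant f] [IsDominant g]
    (s : Y ⟶ S) [IsSeparated s] (hs : f ≫ s = g ≫ s)
    (h : functionFieldMap f = functionFieldMap g) : f = g :=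
  eq_of_fromSpecFunctionField_comp_eq s hs <| by
    rw [← specMap_functionFieldMap, h, specMap_functionFieldMap]

end FunctionFieldMap

section RegularLocus

variable {X Y : Scheme.{u}} [IsIntegral X] [IsIntegral Y]

/-- The open set of points at which the rational function `f` is regular, that is, lies in the local
ring. -/
def regularLocus (f : X.functionField) : X.Opens where
  carrier := {x | f ∈ Set.range (algebraMap (X.presheaf.stalk x) X.functionField)}
  is_open' := by
    rw [isOpen_iff_forall_mem_open]
    rintro x ⟨a, ha⟩
    obtain ⟨U, hx, s, hs⟩ := X.presheaf.exists_germ_eq a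
    refine ⟨U, fun y hy ↦ ⟨X.presheaf.germ U y hy s, ?_⟩, U.2, hx⟩
    have : Nonempty U := ⟨⟨_, hx⟩⟩
    rw [← ha, ← hs, Scheme.algebraMap_germ_eq_germToFunctionField,
      Scheme.algebraMap_germ_eq_germToFunctionField]

theorem mem_regularLocus_functionFieldMap (g : X ⟶ Y) [IsDominant g] {f : Y.functionField} {x : X}
    (h : g x ∈ regularLocus f) : x ∈ regularLocus ((functionFieldMap g).hom f) := by
  obtain ⟨a, ha⟩ := h
  exact ⟨g.stalkMap x a, by rw [← functionFieldMap_algebraMap_stalk, ha]⟩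

theorem genericPoint_mem_regularLocus (f : X.functionField) :
    genericPoint X ∈ regularLocus f :=
  ⟨f, congr($(X.presheaf.stalkSpecializes_refl (genericPoint X)) f)⟩

theorem exists_germ_eq_of_mem_regularLocus {f : X.functionField} {x : X} (h : x ∈ regularLocus f) :
    ∃ (U : X.Opens) (_ : x ∈ U) (hU : genericPoint X ∈ U) (s : Γ(X, U)),
      X.presheaf.germ U _ hU s = f := by
  obtain ⟨a, rfl⟩ := h
  obtain ⟨U, hx, s, rfl⟩ := X.presheaf.exists_germ_eq a
  have : Nonempty U := ⟨⟨_, hx⟩⟩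
  exact ⟨U, hx, (genericPoint_specializes _).mem_open U.2 hx, s,
    (Scheme.algebraMap_germ_eq_germToFunctionField ..).symm⟩

theorem exists_germ_eq_of_le_regularLocus {f : X.functionField} {V : X.Opens}
    (hη : genericPoint X ∈ V) (hV : V ≤ regularLocus f) :
    ∃ s : Γ(X, V), X.presheaf.germ V _ hη s = f := by
  choose U hxU hU s hs using fun x : V ↦ exists_germ_eq_of_mem_regularLocus (hV x.2)
  let W (x : V) : X.Opens := U x ⊓ V
  have hW (x : V) : genericPoint X ∈ W x := ⟨hU x, hη⟩
  let sW (x : V) : Γ(X, W x) := X.presheaf.map (homOfLE inf_le_left).op (s x)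
  have hsW (x : V) : X.presheaf.germ (W x) _ (hW x) (sW x) = f :=
    (X.presheaf.germ_res_apply ..).trans (hs x)
  obtain ⟨t, ht, -⟩ := X.sheaf.existsUnique_gluing' W V (fun x ↦ homOfLE inf_le_right)
    (fun x hx ↦ TopologicalSpace.Opens.mem_iSup.mpr ⟨⟨x, hx⟩, hxU _, hx⟩) sW fun x y ↦
      germ_injective_of_isIntegral (X := X) (U := W x ⊓ W y) (genericPoint X) ⟨hW x, hW y⟩ <|
        calc
          _ = X.presheaf.germ (W x) _ (hW x) (sW x) := X.presheaf.germ_res_apply ..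
          _ = X.presheaf.germ (W y) _ (hW y) (sW y) := (hsW x).trans (hsW y).symm
          _ = _ := (X.presheaf.germ_res_apply ..).symm
  refine ⟨t, ?_⟩
  rw [← hsW ⟨_, hη⟩, ← ht]
  exact (X.presheaf.germ_res_apply ..).symm

end RegularLocus

section FiniteOfDegree

/-- The ring homomorphism `φ : R →+* S` makes `S` a finite `R`-module of rank `n`. For fields this
says that the extension is finite of degree `n`. -/
def FiniteOfDegree {R S : Type*} [CommRing R] [CommRing S] (φ : R →+* S) (n : ℕ) : Prop :=
  letI := φ.toAlgebra
  Module.Finite R S ∧ Module.finrank R S = n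

theorem finiteOfDegree_comp_ringEquiv_iff {R R' S : Type*} [CommRing R] [CommRing R'] [CommRing S]
    (φ : R' →+* S) (e : R ≃+* R') (n : ℕ) :
    FiniteOfDegree (φ.comp e.toRingHom) n ↔ FiniteOfDegree φ n := by
  let _ := (φ.comp e.toRingHom).toAlgebra
  let _ := φ.toAlgebra
  have hcomm : (algebraMap R' S).comp e.toRingHom =
      (RingEquiv.refl S).toRingHom.comp (algebraMap R S) := rfl
  have hcomm' : (algebraMap R S).comp e.symm.toRingHom =
      (RingEquiv.refl S).toRingHom.comp (algebraMap R' S) :=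
    RingHom.ext fun x ↦ congrArg φ (e.apply_symm_apply x)
  have hfinite : Module.Finite R S ↔ Module.Finite R' S :=
    ⟨fun _ ↦ .of_equiv_equiv e (.refl S) hcomm, fun _ ↦ .of_equiv_equiv e.symm (.refl S) hcomm'⟩
  exact and_congr hfinite (by rw [Algebra.finrank_eq_of_equiv_equiv e (.refl S) hcomm])

theorem exists_comp_eq_of_range_subset {R S T : Type*} [CommRing R] [CommRing S] [CommRing T]
    {ψ : S →+* T} (hψ : Function.Injective ψ) {φ : R →+* T} (h : Set.range φ ⊆ Set.range ψ) :
    ∃ χ : R →+* S, ψ.comp χ = φ := by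
  let e : S ≃+* ψ.range := .ofBijective ψ.rangeRestrict
    ⟨fun _ _ h ↦ hψ (congrArg Subtype.val h), ψ.rangeRestrict_surjective⟩
  let φ' : R →+* ψ.range := φ.codRestrict ψ.range fun r ↦ h ⟨r, rfl⟩
  exact ⟨e.symm.toRingHom.comp φ',
    RingHom.ext fun r ↦ congrArg Subtype.val (e.apply_symm_apply (φ' r))⟩

namespace FiniteOfDegree

variable {F E K : Type*} [Field F] [Field E] [Field K] {φ : F →+* E} {ψ : E →+* K} {m n : ℕ}

theorem comp (hφ : FiniteOfDegree φ m) (hψ : FiniteOfDegree ψ n) :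
    FiniteOfDegree (ψ.comp φ) (m * n) := by
  algebraize [φ, ψ, ψ.comp φ]
  obtain ⟨_, rfl⟩ : Module.Finite F E ∧ Module.finrank F E = m := hφ
  obtain ⟨_, rfl⟩ : Module.Finite E K ∧ Module.finrank E K = n := hψ
  exact ⟨.trans E K, (Module.finrank_mul_finrank F E K).symm⟩

theorem of_comp (h : FiniteOfDegree (ψ.comp φ) (m * n)) (hψ : FiniteOfDegree ψ n) :
    FiniteOfDegree φ m := by
  algebraize [φ, ψ, ψ.comp φ]
  obtain ⟨_, hmn⟩ : Module.Finite F K ∧ Module.finrank F K = m * n := h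
  obtain ⟨_, rfl⟩ : Module.Finite E K ∧ Module.finrank E K = n := hψ
  refine ⟨.of_injective (IsScalarTower.toAlgHom F E K).toLinearMap (algebraMap E K).injective, ?_⟩
  rw [← Module.finrank_mul_finrank F E K] at hmn
  exact Nat.eq_of_mul_eq_mul_right Module.finrank_pos hmn

theorem of_fieldRange_eq {S : Subfield E} (hS : φ.fieldRange = S)
    (h : FiniteOfDegree S.subtype n) : FiniteOfDegree φ n := by
  subst hS
  exact (finiteOfDegree_comp_ringEquiv_iff φ.fieldRange.subtype
    φ.rangeRestrictFieldEquiv n).mpr h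

theorem isIntegral (h : FiniteOfDegree φ n) : φ.IsIntegral := by
  algebraize [φ]
  have : Module.Finite F E := h.1
  exact Algebra.IsIntegral.isIntegral

theorem card_le_of_comp_eq {ι : Type*} (h : FiniteOfDegree φ n) {χ : F →+* K} {σ : ι → E →+* K}
    (hσ : Function.Injective σ) (hσχ : ∀ i, (σ i).comp φ = χ) : ENat.card ι ≤ n := by
  algebraize [φ, χ]
  obtain ⟨_, rfl⟩ : Module.Finite F E ∧ Module.finrank F E = n := h
  let τ (i : ι) : E →ₐ[F] K := { σ i with commutes' := fun x ↦ congr($(hσχ i) x) }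
  have hτ : Function.Injective τ := fun i j hij ↦ hσ (congrArg AlgHom.toRingHom hij)
  have := Finite.of_injective τ hτ
  rw [ENat.card_eq_coe_natCard, Nat.cast_le]
  exact (Nat.card_le_card_of_injective τ hτ).trans (card_algHom_le_finrank F E K)

end FiniteOfDegree

theorem hasDegree_iff {X Y : Scheme.{0}} [IsIntegral X] [IsIntegral Y] (f : X ⟶ Y) [IsDominant f]
    (n : ℕ) : HasDegree f n ↔ FiniteOfDegree (functionFieldMap f).hom n := by
  have h : FiniteOfDegree (functionFieldMap f).hom n ↔
      FiniteOfDegree (f.stalkMap (genericPoint X)).hom n :=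
    finiteOfDegree_comp_ringEquiv_iff _ (Y.presheaf.stalkCongr
      (.of_eq (map_genericPoint_of_isDominant f).symm)).commRingCatIsoToRingEquiv n
  rw [h]
  exact ⟨fun ⟨_, _, _, h⟩ ↦ h, fun h ↦ ⟨inferInstance, inferInstance, inferInstance, h⟩⟩

end FiniteOfDegree

section Invariants

/-- The group of automorphisms of `X` over `w : X ⟶ Y`, the deck transformations of `w`. -/
def deckGroup {𝒞 : Type*} [Category 𝒞] {X Y : 𝒞} (w : X ⟶ Y) : Subgroup (Aut X) where
  carrier := {γ | γ.hom ≫ w = w}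
  mul_mem' {γ δ} (hγ : γ.hom ≫ w = w) (hδ : δ.hom ≫ w = w) :=
    show (δ.hom ≫ γ.hom) ≫ w = w by rw [Category.assoc, hγ, hδ]
  one_mem' := Category.id_comp w
  inv_mem' {γ} (hγ : γ.hom ≫ w = w) := (Iso.inv_comp_eq γ).mpr hγ.symm

theorem deckGroup_le_deckGroup_comp {𝒞 : Type*} [Category 𝒞] {X Y Z : 𝒞} (f : X ⟶ Y) (g : Y ⟶ Z) :
    deckGroup f ≤ deckGroup (f ≫ g) :=
  fun γ (hγ : γ.hom ≫ f = f) ↦ show γ.hom ≫ f ≫ g = f ≫ g by rw [reassoc_of% hγ]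

instance isIso_left_aut {S : Scheme.{u}} {X : Over S} (γ : Aut X) : IsIso γ.hom.left :=
  ((Over.forget S).mapIso γ).isIso_hom

variable {S : Scheme.{u}} {X Y : Over S} [IsIntegral X.left] [IsIntegral Y.left]

theorem functionFieldMap_deckGroup (w : X ⟶ Y) [IsDominant w.left] {γ : Aut X}
    (hγ : γ ∈ deckGroup w) :
    functionFieldMap w.left ≫ functionFieldMap γ.hom.left = functionFieldMap w.left := by
  rw [← functionFieldMap_comp]
  exact functionFieldMap_congr congr(($hγ).left)

theorem functionFieldMap_aut_injective [IsSeparated X.hom] :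
    Function.Injective fun γ : Aut X ↦ (functionFieldMap γ.hom.left).hom := fun γ δ h ↦
  Iso.ext <| Over.OverMorphism.ext <|
    eq_of_functionFieldMap_eq X.hom (by simp) (CommRingCat.hom_ext h)

/-- The action of the automorphisms of `X` on its function field. Pulling back along `γ` reverses
products, so `γ` acts by pulling back along `γ⁻¹`. -/
noncomputable def autFunctionField (X : Over S) [IsIntegral X.left] :
    Aut X →* RingAut X.left.functionField where
  toFun γ := .ofRingHom (functionFieldMap γ⁻¹.hom.left).hom (functionFieldMap γ.hom.left).hom
    congr(($(functionFieldMap_comp_eq_id (f := γ⁻¹.hom.left) (g := γ.hom.left)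
      (congrArg (·.left) γ.inv_hom_id))).hom)
    congr(($(functionFieldMap_comp_eq_id (f := γ.hom.left) (g := γ⁻¹.hom.left)
      (congrArg (·.left) γ.hom_inv_id))).hom)
  map_one' := RingEquiv.ext fun f ↦ congr($(functionFieldMap_id X.left) f)
  map_mul' γ δ := RingEquiv.ext fun f ↦
    congr($(functionFieldMap_comp γ⁻¹.hom.left δ⁻¹.hom.left) f)

theorem autFunctionField_inv_apply (γ : Aut X) (f : X.left.functionField) :
    autFunctionField X γ⁻¹ f = (functionFieldMap γ.hom.left).hom f := rfl

theorem autFunctionField_injective [IsSeparated X.hom] :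
    Function.Injective (autFunctionField X) := fun γ δ h ↦ by
  have hinv : (functionFieldMap γ⁻¹.hom.left).hom = (functionFieldMap δ⁻¹.hom.left).hom :=
    RingHom.ext fun f ↦ congr($h f)
  exact inv_injective (functionFieldMap_aut_injective hinv)

/-- The field `K(X)^Γ` of rational functions that are invariant under `Γ`. -/
noncomputable def invariantSubfield (Γ : Subgroup (Aut X)) : Subfield X.left.functionField :=
  letI := MulSemiringAction.compHom X.left.functionField ((autFunctionField X).comp Γ.subtype)
  FixedPoints.subfield Γ X.left.functionField

theorem mem_invariantSubfield {Γ : Subgroup (Aut X)} {f : X.left.functionField} :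
    f ∈ invariantSubfield Γ ↔ ∀ γ ∈ Γ, (functionFieldMap γ.hom.left).hom f = f := by
  refine ⟨fun h γ hγ ↦ h ⟨γ⁻¹, inv_mem hγ⟩, fun h γ ↦ ?_⟩
  have := h γ⁻¹ (inv_mem γ.2)
  rwa [← autFunctionField_inv_apply, inv_inv] at this

theorem invariantSubfield_antitone : Antitone (invariantSubfield (X := X)) :=
  fun _ _ hΓ _ hf ↦ mem_invariantSubfield.mpr fun γ hγ ↦ mem_invariantSubfield.mp hf γ (hΓ hγ)

theorem fieldRange_functionFieldMap_le_invariantSubfield (w : X ⟶ Y) [IsDominant w.left] :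
    (functionFieldMap w.left).hom.fieldRange ≤ invariantSubfield (deckGroup w) := by
  rintro _ ⟨f, rfl⟩
  exact mem_invariantSubfield.mpr fun γ hγ ↦ congr($(functionFieldMap_deckGroup w hγ) f)

theorem finiteOfDegree_invariantSubfield_subtype [IsSeparated X.hom] (Γ : Subgroup (Aut X))
    [Finite Γ] : FiniteOfDegree (invariantSubfield Γ).subtype (Nat.card Γ) := by
  let _ := MulSemiringAction.compHom X.left.functionField ((autFunctionField X).comp Γ.subtype)
  have : FaithfulSMul Γ X.left.functionField :=
    ⟨fun h ↦ Subtype.ext (autFunctionField_injective (RingEquiv.ext h))⟩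
  have := Fintype.ofFinite Γ
  rw [Nat.card_eq_fintype_card, ← FixedPoints.finrank_eq_card Γ X.left.functionField]
  exact ⟨inferInstanceAs (Module.Finite (FixedPoints.subfield Γ X.left.functionField) _), rfl⟩

theorem card_deckGroup_le (w : X ⟶ Y) [IsDominant w.left] [IsSeparated X.hom] {n : ℕ}
    (hw : FiniteOfDegree (functionFieldMap w.left).hom n) : ENat.card (deckGroup w) ≤ n :=
  hw.card_le_of_comp_eq (σ := fun γ : deckGroup w ↦ (functionFieldMap γ.1.hom.left).hom)
    (functionFieldMap_aut_injective.comp Subtype.val_injective)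
    fun γ ↦ congr(($(functionFieldMap_deckGroup w γ.2)).hom)

end Invariants

namespace IsQuotientByGroup

variable {X Y : Over SpecC} {Γ : Subgroup (Aut X)} {π : X ⟶ Y}

theorem surjective_left (h : IsQuotientByGroup Γ π) : Surjective π.left :=
  ⟨h.isQuotientMap.surjective⟩

theorem isIntegral_left [IsIntegral X.left] (h : IsQuotientByGroup Γ π) : IsIntegral Y.left where
  nonempty := (inferInstance : Nonempty X.left).map π.left
  component_integral U hU := by
    obtain ⟨⟨y, hy⟩⟩ := hU
    obtain ⟨x, rfl⟩ := h.isQuotientMap.surjective y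
    have : Nonempty (π.left ⁻¹ᵁ U) := ⟨⟨x, hy⟩⟩
    exact (h.app_injective U).isDomain (π.left.app U).hom

theorem le_deckGroup (h : IsQuotientByGroup Γ π) : Γ ≤ deckGroup π := h.invariant

variable [IsIntegral X.left]

theorem preimage_image_regularLocus (h : IsQuotientByGroup Γ π) {f : X.left.functionField}
    (hf : f ∈ invariantSubfield Γ) :
    π.left ⁻¹' (π.left '' (regularLocus f : Set X.left)) = regularLocus f := by
  refine (Set.subset_preimage_image _ _).antisymm' ?_
  rintro x ⟨y, hy, hyx⟩
  obtain ⟨γ, hγ, rfl⟩ := h.exists_of_eq x y hyx.symm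
  rw [SetLike.mem_coe, ← mem_invariantSubfield.mp hf γ hγ]
  exact mem_regularLocus_functionFieldMap γ.hom.left hy

variable [IsIntegral Y.left] [IsDominant π.left]

theorem exists_mem_regularLocus (h : IsQuotientByGroup Γ π) {f : X.left.functionField}
    (hf : f ∈ invariantSubfield Γ) {x : X.left} (hx : x ∈ regularLocus f) :
    ∃ g : Y.left.functionField, (functionFieldMap π.left).hom g = f ∧
      π.left x ∈ regularLocus g := by
  let U : Y.left.Opens := ⟨π.left '' (regularLocus f : Set X.left), by
    rw [← h.isQuotientMap.isOpen_preimage, h.preimage_image_regularLocus hf]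
    exact (regularLocus f).2⟩
  have hU : π.left ⁻¹ᵁ U = regularLocus f :=
    TopologicalSpace.Opens.ext (h.preimage_image_regularLocus hf)
  have hη : genericPoint X.left ∈ π.left ⁻¹ᵁ U := hU ▸ genericPoint_mem_regularLocus f
  have hηY : genericPoint Y.left ∈ U := map_genericPoint_of_isDominant π.left ▸ hη
  obtain ⟨s, hs⟩ := exists_germ_eq_of_le_regularLocus hη hU.le
  obtain ⟨t, ht⟩ := h.mem_range_app U s fun γ hγ hle ↦ by
    apply germ_injective_of_isIntegral X.left _ hη
    rw [hs, ← functionFieldMap_germ γ.hom.left _ _ hle hη hη, hs, mem_invariantSubfield.mp hf γ hγ]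
  have : Nonempty U := ⟨⟨_, hηY⟩⟩
  refine ⟨Y.left.presheaf.germ U _ hηY t, ?_, Y.left.presheaf.germ U (π.left x) ⟨x, hx, rfl⟩ t,
    Scheme.algebraMap_germ_eq_germToFunctionField ..⟩
  rw [functionFieldMap_germ π.left U _ le_rfl hηY hη, Scheme.Hom.appLE_eq_app, ← hs, ← ht]

theorem fieldRange_functionFieldMap (h : IsQuotientByGroup Γ π) :
    (functionFieldMap π.left).hom.fieldRange = invariantSubfield Γ := by
  refine le_antisymm ((fieldRange_functionFieldMap_le_invariantSubfield π).trans
    (invariantSubfield_antitone h.le_deckGroup)) fun f hf ↦ ?_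
  obtain ⟨g, hg, -⟩ := h.exists_mem_regularLocus hf (genericPoint_mem_regularLocus f)
  exact ⟨g, hg⟩

theorem finiteOfDegree [IsSeparated X.hom] [Finite Γ] (h : IsQuotientByGroup Γ π) :
    FiniteOfDegree (functionFieldMap π.left).hom (Nat.card Γ) :=
  .of_fieldRange_eq h.fieldRange_functionFieldMap (finiteOfDegree_invariantSubfield_subtype Γ)

theorem mem_regularLocus_of_functionFieldMap (h : IsQuotientByGroup Γ π)
    {g : Y.left.functionField} {x : X.left}
    (hx : x ∈ regularLocus ((functionFieldMap π.left).hom g)) : π.left x ∈ regularLocus g := by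
  have hg : (functionFieldMap π.left).hom g ∈ invariantSubfield Γ :=
    h.fieldRange_functionFieldMap ▸ ⟨g, rfl⟩
  obtain ⟨g', hg', hxg'⟩ := h.exists_mem_regularLocus hg hx
  rwa [← (functionFieldMap π.left).hom.injective hg']

theorem valuationRing_stalk (h : IsQuotientByGroup Γ π)
    (hX : ∀ x : X.left, ValuationRing (X.left.presheaf.stalk x)) (y : Y.left) :
    ValuationRing (Y.left.presheaf.stalk y) := by
  obtain ⟨x, rfl⟩ := h.isQuotientMap.surjective y
  have := hX x
  rw [ValuationRing.iff_isInteger_or_isInteger _ Y.left.functionField]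
  intro g
  refine (ValuationRing.isInteger_or_isInteger (X.left.presheaf.stalk x)
    ((functionFieldMap π.left).hom g)).imp h.mem_regularLocus_of_functionFieldMap fun hx ↦
      h.mem_regularLocus_of_functionFieldMap ?_
  rwa [map_inv₀]

end IsQuotientByGroup

theorem DiagramCompletes.card_sup_le {D B C : Over SpecC} [IsIntegral D.left] [IsSeparated D.hom]
    {Γ₁ Γ₂ : Subgroup (Aut D)} [Finite Γ₁] {p : D ⟶ B} {q : D ⟶ C} (hp : IsQuotientByGroup Γ₁ p)
    (hq : IsQuotientByGroup Γ₂ q) {d e : ℕ} (h : DiagramCompletes p q d e) :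
    ENat.card ↥(Γ₁ ⊔ Γ₂) ≤ d * Nat.card Γ₁ := by
  obtain ⟨H, u, v, -, hu, -, huv⟩ := h
  obtain ⟨_, _, _, -⟩ := id hu
  have := hp.surjective_left
  have : IsDominant (p ≫ u).left := inferInstanceAs (IsDominant (p.left ≫ u.left))
  have hsup : Γ₁ ⊔ Γ₂ ≤ deckGroup (p ≫ u) :=
    sup_le (hp.le_deckGroup.trans (deckGroup_le_deckGroup_comp p u))
      (huv ▸ hq.le_deckGroup.trans (deckGroup_le_deckGroup_comp q v))
  have hdeg : FiniteOfDegree (functionFieldMap (p ≫ u).left).hom (d * Nat.card Γ₁) := by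
    have := ((hasDegree_iff u.left d).mp hu).comp hp.finiteOfDegree
    rwa [← CommRingCat.hom_comp, ← functionFieldMap_comp] at this
  calc ENat.card ↥(Γ₁ ⊔ Γ₂)
    _ ≤ ENat.card (deckGroup (p ≫ u)) :=
      ENat.card_le_card_of_injective (Subgroup.inclusion_injective hsup)
    _ ≤ (d * Nat.card Γ₁ : ℕ) := card_deckGroup_le _ hdeg
    _ = d * Nat.card Γ₁ := Nat.cast_mul ..

section Smooth

open TensorProduct

theorem isFractionRing_tensorProduct_of_etale (R S K : Type*) [CommRing R] [IsDomain R] [CommRing S]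
    [IsDomain S] [Algebra R S] [Algebra.Etale R S] [Field K] [Algebra R K] [IsFractionRing R K] :
    IsFractionRing S (S ⊗[R] K) := by
  let _ : Algebra K (S ⊗[R] K) := Algebra.TensorProduct.rightAlgebra
  have hM : Algebra.algebraMapSubmonoid S (nonZeroDivisors R) ≤ nonZeroDivisors S :=
    map_le_nonZeroDivisors_of_injective _ (FaithfulSMul.algebraMap_injective R S) le_rfl
  have := IsLocalization.isDomain_of_le_nonZeroDivisors (S ⊗[R] K) hM
  have : Algebra.Etale K (S ⊗[R] K) := .of_equiv
    { Algebra.TensorProduct.comm R K S with commutes' := fun _ ↦ rfl }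
  have := Algebra.FormallyUnramified.finite_of_free K (S ⊗[R] K)
  have hfield := isField_of_isIntegral_of_isField' (S := S ⊗[R] K) (Field.toIsField K)
  let _ := hfield.toField
  have : FaithfulSMul S (S ⊗[R] K) := (faithfulSMul_iff_algebraMap_injective _ _).mpr
    (IsLocalization.injective _ hM)
  refine .of_field S (S ⊗[R] K) fun z ↦ ?_
  obtain ⟨s, m, rfl⟩ :=
    IsLocalization.exists_mk'_eq (Algebra.algebraMapSubmonoid S (nonZeroDivisors R)) z
  refine ⟨s, m, eq_div_of_mul_eq ?_ (IsLocalization.mk'_spec _ s m)⟩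
  exact (IsLocalization.map_units (S ⊗[R] K) m).ne_zero

theorem isIntegrallyClosed_of_etale (R S : Type*) [CommRing R] [IsDomain R] [IsIntegrallyClosed R]
    [CommRing S] [IsDomain S] [Algebra R S] [Algebra.Etale R S] : IsIntegrallyClosed S := by
  have := isFractionRing_tensorProduct_of_etale R S (FractionRing R)
  refine (isIntegrallyClosed_iff (S ⊗[R] FractionRing R)).mpr fun {x} hx ↦ ?_
  have hR : Function.Surjective (algebraMap R (integralClosure R (FractionRing R))) := fun c ↦ by
    obtain ⟨r, hr⟩ := IsIntegrallyClosed.isIntegral_iff.mp c.2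
    exact ⟨r, Subtype.ext hr⟩
  obtain ⟨y, hy⟩ := (TensorProduct.toIntegralClosure_bijective_of_smooth (R := R) (S := S)
    (B := FractionRing R)).2 ⟨x, hx⟩
  obtain ⟨s, rfl⟩ := Algebra.TensorProduct.includeLeft_surjective S S hR y
  exact ⟨s, congr(($hy).1)⟩

theorem isIntegrallyClosed_of_isStandardSmooth {R S : Type*} [CommRing R] [IsDomain R]
    [UniqueFactorizationMonoid R] [CommRing S] [IsDomain S] {φ : R →+* S}
    (hφ : φ.IsStandardSmooth) : IsIntegrallyClosed S := by
  obtain ⟨n, ψ, -, hψ⟩ := hφ.exists_etale_mvPolynomial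
  algebraize [ψ]
  exact isIntegrallyClosed_of_etale (MvPolynomial (Fin n) R) S

theorem isIntegrallyClosed_stalk_of_smooth {X : Scheme.{u}} [IsIntegral X] {k : Type u} [Field k]
    (f : X ⟶ Spec (.of k)) [Smooth f] (x : X) : IsIntegrallyClosed (X.presheaf.stalk x) := by
  obtain ⟨U, -, V, hV, hx, hVU, hφ⟩ := Smooth.exists_isStandardSmooth f x
  have : Subsingleton (Spec (CommRingCat.of k)) := inferInstanceAs (Subsingleton (PrimeSpectrum k))
  obtain rfl : U = ⊤ := eq_top_iff.mpr fun y _ ↦ Subsingleton.elim (f x) y ▸ hVU hx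
  let _ := (isField_of_isIntegral_of_subsingleton (Spec (CommRingCat.of k))).toField
  have : Nonempty V := ⟨⟨x, hx⟩⟩
  have := isIntegrallyClosed_of_isStandardSmooth hφ
  let _ : Algebra Γ(X, V) (X.presheaf.stalk x) := (X.presheaf.germ V x hx).hom.toAlgebra
  have := hV.isLocalization_stalk ⟨x, hx⟩
  exact isIntegrallyClosed_of_isLocalization (R := Γ(X, V)) _ _
    (hV.primeIdealOf ⟨x, hx⟩).asIdeal.primeCompl_le_nonZeroDivisors

open Order in
theorem coheight_le_topologicalKrullDim {X : Type*} [TopologicalSpace X] [QuasiSober X] [T0Space X]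
    (x : X) :
    letI := specializationOrder X
    (coheight x : WithBot ℕ∞) ≤ topologicalKrullDim X := by
  let _ := specializationOrder X
  rw [← coheight_orderIso (irreducibleSetEquivPoints (α := X)).symm x]
  exact coheight_le_krullDim _

theorem valuationRing_of_isIntegrallyClosed (R : Type*) [CommRing R] [IsDomain R] [IsLocalRing R]
    [IsNoetherianRing R] [IsIntegrallyClosed R] [Ring.KrullDimLE 1 R] : ValuationRing R := by
  have hmax := Ring.krullDimLE_one_iff_of_noZeroDivisors.mp ‹Ring.KrullDimLE 1 R›
  have h : IsIntegrallyClosed R ∧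
      ∀ P : Ideal R, P ≠ ⊥ → P.IsPrime → P = IsLocalRing.maximalIdeal R :=
    ⟨inferInstance, fun P hP hP' ↦ IsLocalRing.eq_maximalIdeal (hmax P hP hP')⟩
  exact ((tfae_of_isNoetherianRing_of_isLocalRing_of_isDomain R).out 3 1).mp h

theorem valuationRing_stalk_of_smooth {X : Scheme.{u}} [IsIntegral X] {k : Type u} [Field k]
    (f : X ⟶ Spec (.of k)) [Smooth f] (hX : topologicalKrullDim X ≤ 1) (x : X) :
    ValuationRing (X.presheaf.stalk x) := by
  have := isIntegrallyClosed_stalk_of_smooth f x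
  have : IsLocallyNoetherian X := LocallyOfFiniteType.isLocallyNoetherian f
  have : Ring.KrullDimLE 1 (X.presheaf.stalk x) := by
    rw [Ring.krullDimLE_iff, ringKrullDim_stalk_eq_coheight]
    exact (coheight_le_topologicalKrullDim x).trans hX
  exact valuationRing_of_isIntegrallyClosed _

end Smooth

section Dimension

theorem krullDim_le_of_fibration {α β : Type*} [Preorder α] [Preorder β] {f : α → β}
    (hf : Monotone f) (hs : Function.Surjective f)
    (hlift : Relation.Fibration (· ≤ ·) (· ≤ ·) f) : Order.krullDim β ≤ Order.krullDim α := by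
  have hchain (s : LTSeries β) : ∃ t : LTSeries α, t.length = s.length ∧ f t.head = s.head := by
    induction s using RelSeries.inductionOn with
    | singleton b =>
      obtain ⟨a, ha⟩ := hs b
      exact ⟨.singleton _ a, rfl, ha⟩
    | cons s b hb ih =>
      obtain ⟨t, hts, hhead⟩ := ih
      have hlt : b < f t.head := hhead ▸ hb
      obtain ⟨a, ha, rfl⟩ := hlift hlt.le
      exact ⟨t.cons a (ha.lt_of_not_ge fun h ↦ hlt.not_ge (hf h)), by simp [hts], by simp⟩
  refine iSup_le fun s ↦ ?_
  obtain ⟨t, ht, -⟩ := hchain s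
  exact ht ▸ Order.LTSeries.length_le_krullDim t

theorem topologicalKrullDim_le_of_specializingMap {X Y : Type*} [TopologicalSpace X]
    [TopologicalSpace Y] [QuasiSober X] [T0Space X] [QuasiSober Y] [T0Space Y] {f : X → Y}
    (hc : Continuous f) (hs : Function.Surjective f) (hf : SpecializingMap f) :
    topologicalKrullDim Y ≤ topologicalKrullDim X := by
  let _ := specializationOrder X
  let _ := specializationOrder Y
  rw [topologicalKrullDim, topologicalKrullDim,
    Order.krullDim_eq_of_orderIso (irreducibleSetEquivPoints (α := X)),
    Order.krullDim_eq_of_orderIso (irreducibleSetEquivPoints (α := Y))]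
  exact krullDim_le_of_fibration (fun _ _ h ↦ h.map hc) hs hf

theorem one_le_topologicalKrullDim_iff {X : Type*} [TopologicalSpace X] [QuasiSober X] [T0Space X]
    [IrreducibleSpace X] : 1 ≤ topologicalKrullDim X ↔ ∃ x : X, x ≠ genericPoint X := by
  let _ := specializationOrder X
  have hle (x : X) : x ≤ genericPoint X := genericPoint_specializes x
  rw [topologicalKrullDim, Order.krullDim_eq_of_orderIso (irreducibleSetEquivPoints (α := X)),
    Order.one_le_krullDim_iff]
  exact ⟨fun ⟨x, y, hxy⟩ ↦ ⟨x, (hxy.trans_le (hle y)).ne⟩,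
    fun ⟨x, hx⟩ ↦ ⟨x, _, (hle x).lt_of_ne hx⟩⟩

theorem eq_genericPoint_of_isField_stalk {X : Scheme.{u}} [IsIntegral X] {x : X}
    (h : IsField (X.presheaf.stalk x)) : x = genericPoint X := by
  let _ := h.toField
  have : Subsingleton (Spec (X.presheaf.stalk x)) :=
    inferInstanceAs (Subsingleton (PrimeSpectrum (X.presheaf.stalk x)))
  have hrange := Scheme.range_fromSpecStalk (X := X) (x := x)
  obtain ⟨a, ha⟩ := hrange.ge (specializes_refl x)
  obtain ⟨b, hb⟩ := hrange.ge (genericPoint_specializes x)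
  rw [← ha, ← hb, Subsingleton.elim a b]

theorem eq_genericPoint_of_isIntegral_functionFieldMap {X Y : Scheme.{u}} [IsIntegral X]
    [IsIntegral Y] (f : X ⟶ Y) [IsDominant f] (hf : (functionFieldMap f).hom.IsIntegral) {x : X}
    (hx : f x = genericPoint Y) : x = genericPoint X := by
  have hinj := IsFractionRing.injective (X.presheaf.stalk x) X.functionField
  obtain ⟨χ, hχ⟩ := exists_comp_eq_of_range_subset hinj (φ := (functionFieldMap f).hom) <|
    Set.range_subset_iff.mpr fun g ↦
      mem_regularLocus_functionFieldMap f (hx ▸ genericPoint_mem_regularLocus g)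
  have : Algebra.IsIntegral (X.presheaf.stalk x) X.functionField :=
    ⟨RingHom.IsIntegral.tower_top χ _ (hχ ▸ hf)⟩
  exact eq_genericPoint_of_isField_stalk
    (isField_of_isIntegral_of_isField hinj (Field.toIsField X.functionField))

theorem topologicalKrullDim_eq_one_of_isProper {X Y : Scheme.{u}} [IsIntegral X] [IsIntegral Y]
    (f : X ⟶ Y) [IsDominant f] [IsProper f] (hf : (functionFieldMap f).hom.IsIntegral)
    (hX : topologicalKrullDim X = 1) : topologicalKrullDim Y = 1 := by
  have hclosed : IsClosedMap f := f.isClosedMap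
  have hsurj : Function.Surjective f := by
    rw [← Set.range_eq_univ, ← hclosed.isClosed_range.closure_eq, f.denseRange.closure_range]
  refine le_antisymm (hX ▸ topologicalKrullDim_le_of_specializingMap f.continuous hsurj
    hclosed.specializingMap) ?_
  obtain ⟨x, hx⟩ := one_le_topologicalKrullDim_iff.mp hX.ge
  exact one_le_topologicalKrullDim_iff.mpr
    ⟨f x, fun h ↦ hx (eq_genericPoint_of_isIntegral_functionFieldMap f hf h)⟩

end Dimension

section Extension

theorem exists_lift_of_valuationRing {X S : Scheme.{u}} (f : X ⟶ S) [UniversallyClosed f]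
    {R K : CommRingCat.{u}} [IsDomain R] [ValuationRing R] (φ : R ⟶ K)
    (hφ : letI := φ.hom.toAlgebra; IsFractionRing R K) (g : Spec K ⟶ X) (s : Spec R ⟶ S)
    (h : g ≫ f = Spec.map φ ≫ s) : ∃ l : Spec R ⟶ X, Spec.map φ ≫ l = g ∧ l ≫ f = s := by
  let _ : Algebra R K := φ.hom.toAlgebra
  let _ : Field K := IsFractionRing.toField R
  have hf : UniversallyClosed f := inferInstance
  rw [UniversallyClosed.eq_valuativeCriterion] at hf
  obtain ⟨⟨l⟩⟩ := hf.1 { R := R, K := K, i₁ := g, i₂ := s, commSq := ⟨h⟩, isFractionRing := hφ }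
  exact ⟨l.l, l.fac_left, l.fac_right⟩

variable {X Y : Scheme.{u}}

theorem specMap_stalkSpecializes_fromSpecStalkOfMem (m : X.PartialMap Y) {x y : X} (h : x ⤳ y)
    (hx : x ∈ m.domain) (hy : y ∈ m.domain) :
    Spec.map (X.presheaf.stalkSpecializes h) ≫ m.fromSpecStalkOfMem hy =
      m.fromSpecStalkOfMem hx := by
  have hU : Spec.map (X.presheaf.stalkSpecializes h) ≫ m.domain.fromSpecStalkOfMem y hy =
      m.domain.fromSpecStalkOfMem x hx := by
    rw [← cancel_mono m.domain.ι, Category.assoc, Scheme.Opens.fromSpecStalkOfMem_ι,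
      Scheme.Opens.fromSpecStalkOfMem_ι, Scheme.SpecMap_stalkSpecializes_fromSpecStalk]
  exact congr($hU ≫ m.hom)

theorem exists_toRationalMap_eq_of_domain_eq_top [IsReduced X] [Y.IsSeparated] {r : X ⤏ Y}
    (hr : r.domain = ⊤) : ∃ u : X ⟶ Y, u.toRationalMap = r := by
  have hm (m : X.PartialMap Y) (h : m.domain = ⊤) : ∃ u : X ⟶ Y, u.toPartialMap = m := by
    obtain ⟨U, hU, f⟩ := m
    obtain rfl : U = ⊤ := h
    exact ⟨X.topIso.inv ≫ f, congrArg (Scheme.PartialMap.mk ⊤ hU)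
      (X.topIso.hom_inv_id_assoc f)⟩
  obtain ⟨u, hu⟩ := hm r.toPartialMap hr
  exact ⟨u, by rw [Scheme.Hom.toRationalMap, hu, r.toRationalMap_toPartialMap]⟩

variable {S : Scheme.{u}} [IsIntegral X] (sX : X ⟶ S) (sY : Y ⟶ S) [IsProper sY]

theorem mem_domain_of_valuationRing_stalk {r : X ⤏ Y}
    (hr : r.fromFunctionField ≫ sY = fromSpecFunctionField X ≫ sX) (x : X)
    [ValuationRing (X.presheaf.stalk x)] : x ∈ r.domain := by
  have : IsDomain (X.presheaf.stalk x) := inferInstance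
  have hrx : r.fromFunctionField ≫ sY =
      Spec.map (X.presheaf.stalkSpecializes (genericPoint_specializes x)) ≫
        X.fromSpecStalk x ≫ sX := by
    rw [hr, ← Scheme.SpecMap_stalkSpecializes_fromSpecStalk_assoc]
  obtain ⟨l, hlr, hl⟩ := exists_lift_of_valuationRing sY
    (X.presheaf.stalkSpecializes (genericPoint_specializes x))
    (inferInstanceAs (IsFractionRing (X.presheaf.stalk x) X.functionField)) _ _ hrx
  let m : X.PartialMap Y := .ofFromSpecStalk sX sY l hl
  have hx : x ∈ m.domain := Scheme.PartialMap.mem_domain_ofFromSpecStalk ..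
  have hml : m.fromSpecStalkOfMem hx = l := Scheme.PartialMap.fromSpecStalkOfMem_ofFromSpecStalk ..
  have hmr : m.fromFunctionField = r.fromFunctionField := by
    rw [← hlr, ← hml]
    exact (specMap_stalkSpecializes_fromSpecStalkOfMem m (genericPoint_specializes x) _ hx).symm
  exact Scheme.RationalMap.mem_domain.mpr
    ⟨m, hx, Scheme.RationalMap.eq_of_fromFunctionField_eq _ _ hmr⟩

theorem exists_extension_of_valuationRing_stalk [S.IsSeparated]
    (hX : ∀ x : X, ValuationRing (X.presheaf.stalk x)) (g : Spec X.functionField ⟶ Y)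
    (hg : g ≫ sY = fromSpecFunctionField X ≫ sX) :
    ∃ u : X ⟶ Y, u ≫ sY = sX ∧ fromSpecFunctionField X ≫ u = g := by
  have : Y.IsSeparated := ⟨by rw [← Limits.terminal.comp_from sY]; infer_instance⟩
  let r : X ⤏ Y := .ofFunctionField sX sY g hg
  have hrg : r.fromFunctionField = g := Scheme.RationalMap.fromFunctionField_ofFunctionField ..
  have hr : r.domain = ⊤ := eq_top_iff.mpr fun x _ ↦
    have := hX x
    mem_domain_of_valuationRing_stalk sX sY (by rw [hrg, hg]) x
  obtain ⟨u, hu⟩ := exists_toRationalMap_eq_of_domain_eq_top hr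
  have hug : fromSpecFunctionField X ≫ u = g := by
    rw [← hrg, ← hu]
    exact (Scheme.PartialMap.fromSpecStalkOfMem_toPartialMap ..).symm
  refine ⟨u, eq_of_fromSpecFunctionField_comp_eq (Limits.terminal.from S)
    (Limits.terminal.hom_ext _ _) ?_, hug⟩
  rw [← hg, ← hug, Category.assoc]

end Extension

section GenericPoint

variable {X P : Scheme.{u}} {K : Type u} [Field K]

instance isSchemeTheoreticallyDominant_toImage (f : X ⟶ P) [QuasiCompact f] :
    IsSchemeTheoreticallyDominant f.toImage := by
  refine ⟨Scheme.IdealSheafData.ext_of_iSup_eq_top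
    (fun U : P.affineOpens ↦ ⟨f.imageι ⁻¹ᵁ U.1, U.2.preimage _⟩)
    (TopologicalSpace.IsOpenCover.comap (iSup_affineOpens_eq_top _) _) fun U ↦ ?_⟩
  simp only [Scheme.Hom.ker_apply, Scheme.IdealSheafData.ideal_bot, Pi.bot_apply]
  exact (RingHom.injective_iff_ker_eq_bot _).mp (f.toImage_app_injective U)

theorem isIntegral_image [IsIntegral X] (f : X ⟶ P) [QuasiCompact f] : IsIntegral f.image := by
  have hdom : IsDominant f.toImage := inferInstance
  have : IsReduced f.image := IsSchemeTheoreticallyDominant.isReduced f.toImage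
  have : IrreducibleSpace f.image := by
    rw [irreducibleSpace_def, Set.top_eq_univ, ← f.toImage.denseRange.closure_range,
      ← Set.image_univ]
    exact ((IrreducibleSpace.isIrreducible_univ X).image _
      f.toImage.continuous.continuousOn).closure
  exact isIntegral_of_irreducibleSpace_of_isReduced _

theorem apply_eq_genericPoint_of_isDominant [IsIntegral X] (g : Spec (.of K) ⟶ X) [IsDominant g]
    (x : Spec (.of K)) : g x = genericPoint X := by
  have hrange : Set.range g = {g x} := by
    refine Set.Subset.antisymm ?_ (Set.singleton_subset_iff.mpr ⟨x, rfl⟩)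
    rintro _ ⟨y, rfl⟩
    exact congrArg g (Subsingleton.elim (α := PrimeSpectrum K) _ _)
  refine IsGenericPoint.eq ?_ (genericPoint_spec X)
  rw [IsGenericPoint, ← hrange, g.denseRange.closure_range]

theorem exists_specMap_comp_fromSpecFunctionField_eq [IsIntegral X] (g : Spec (.of K) ⟶ X)
    [IsDominant g] :
    ∃ ι : X.functionField ⟶ .of K, Spec.map ι ≫ fromSpecFunctionField X = g := by
  have hη := apply_eq_genericPoint_of_isDominant g (IsLocalRing.closedPoint K)
  refine ⟨X.presheaf.stalkSpecializes (specializes_of_eq hη) ≫ Scheme.stalkClosedPointTo g, ?_⟩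
  rw [Spec.map_comp, Category.assoc, Scheme.SpecMap_stalkSpecializes_fromSpecStalk]
  exact Scheme.Spec_stalkClosedPointTo_fromSpecStalk g

theorem exists_comp_eq_of_isOpenImmersion [IsIntegral X] (i : X ⟶ P)
    (ι : X.functionField ⟶ .of K) {R : CommRingCat.{u}} (j : Spec R ⟶ P) [IsOpenImmersion j]
    (ψ : R ⟶ .of K) (h : Spec.map ι ≫ fromSpecFunctionField X ≫ i = Spec.map ψ ≫ j) :
    ∃ χ : R ⟶ X.functionField, χ ≫ ι = ψ := by
  have hrange : Set.range (fromSpecFunctionField X ≫ i) ⊆ Set.range j := by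
    rintro _ ⟨x, rfl⟩
    have hx : x = Spec.map ι (IsLocalRing.closedPoint K) :=
      Subsingleton.elim (α := PrimeSpectrum X.functionField) _ _
    rw [hx]
    exact ⟨Spec.map ψ (IsLocalRing.closedPoint K),
      congr($h.symm (IsLocalRing.closedPoint K : PrimeSpectrum K))⟩
  refine ⟨Spec.preimage (IsOpenImmersion.lift j (fromSpecFunctionField X ≫ i) hrange), ?_⟩
  apply Spec.map_injective
  rw [Spec.map_comp, Spec.map_preimage, ← cancel_mono j, Category.assoc,
    IsOpenImmersion.lift_fac, h]

end GenericPoint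

section ProjectiveSpace

open MvPolynomial

/-- The homomorphism `A_(f) → K` on the degree-zero part of `A_f` induced by a homomorphism
`e : A → K` that inverts `f`. -/
noncomputable def awayEval {A K σ : Type*} [CommRing A] [CommRing K] [SetLike σ A]
    [AddSubgroupClass σ A] (𝒜 : ℕ → σ) [GradedRing 𝒜] {f : A} (e : A →+* K)
    (he : IsUnit (e f)) : HomogeneousLocalization.Away 𝒜 f →+* K :=
  (IsLocalization.Away.lift (S := Localization.Away f) f he).comp (algebraMap _ _)

theorem awayEval_mk_mul_pow {A K σ : Type*} [CommRing A] [CommRing K] [SetLike σ A]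
    [AddSubgroupClass σ A] (𝒜 : ℕ → σ) [GradedRing 𝒜] {f : A} (e : A →+* K) (he : IsUnit (e f))
    {m : ℕ} (hf : f ∈ 𝒜 m) {n : ℕ} {x : A} (hx : x ∈ 𝒜 (n • m)) :
    awayEval 𝒜 e he (.mk 𝒜 hf n x hx) * e f ^ n = e x := by
  change IsLocalization.Away.lift f he (HomogeneousLocalization.Away.mk 𝒜 hf n x hx).val * _ = _
  rw [HomogeneousLocalization.Away.val_mk, Localization.mk_eq_mk', ← map_pow,
    ← IsLocalization.Away.lift_eq (S := Localization.Away f) f he (f ^ n), ← map_mul,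
    IsLocalization.mk'_spec_mk, IsLocalization.Away.lift_eq]

attribute [local instance] MvPolynomial.gradedAlgebra

variable {σ k K : Type u} [CommRing k] [Field K] [Algebra k K]

variable (σ k) in
/-- The projective space over `k` with homogeneous coordinates indexed by `σ`. -/
noncomputable def projectiveSpace : Over (Spec (.of k)) :=
  Over.mk (Proj.toSpecZero (homogeneousSubmodule σ k) ≫
    Spec.map (CommRingCat.ofHom (algebraMap k (homogeneousSubmodule σ k 0))))

theorem isProper_projectiveSpace [Finite σ] : IsProper (projectiveSpace σ k).hom := by
  let z := algebraMap k (homogeneousSubmodule σ k 0)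
  have hz : Function.Surjective z := fun x ↦ by
    have hx : x.1.totalDegree = 0 := (totalDegree_zero_iff_isHomogeneous _).mpr x.2
    exact ⟨_, Subtype.ext (totalDegree_eq_zero_iff_eq_C.mp hx).symm⟩
  have : IsClosedImmersion (Spec.map (CommRingCat.ofHom z)) :=
    IsClosedImmersion.spec_of_surjective _ hz
  have : Algebra.FiniteType (homogeneousSubmodule σ k 0) (MvPolynomial σ k) :=
    RingHom.FiniteType.of_comp_finiteType (f := z) <| RingHom.finiteType_algebraMap.mpr <|
      inferInstanceAs (Algebra.FiniteType k (MvPolynomial σ k))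
  exact inferInstanceAs (IsProper (Proj.toSpecZero (homogeneousSubmodule σ k) ≫
    Spec.map (CommRingCat.ofHom z)))

variable (k) in
theorem X_mem_homogeneousSubmodule (i : σ) : X i ∈ homogeneousSubmodule σ k 1 :=
  isHomogeneous_X k i

variable (k) in
theorem isUnit_aeval_X {a : σ → K} {i : σ} (ha : a i = 1) :
    IsUnit ((aeval a : MvPolynomial σ k →ₐ[k] K).toRingHom (X i)) := by
  simp [ha]

variable (k) in
/-- The `K`-point of projective space with homogeneous coordinates `a`, normalised by `a i = 1`. -/
noncomputable def projectivePoint (a : σ → K) {i : σ} (ha : a i = 1) :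
    Spec (.of K) ⟶ (projectiveSpace σ k).left :=
  Spec.map (CommRingCat.ofHom (awayEval (homogeneousSubmodule σ k) _ (isUnit_aeval_X k ha))) ≫
    Proj.awayι (homogeneousSubmodule σ k) (X i) (X_mem_homogeneousSubmodule k i) one_pos

theorem awayEval_aeval_mk {a : σ → K} {i : σ} (ha : a i = 1) {n : ℕ} {x : MvPolynomial σ k}
    (hx : x ∈ homogeneousSubmodule σ k (n • 1)) :
    awayEval (homogeneousSubmodule σ k) _ (isUnit_aeval_X k ha)
      (.mk _ (X_mem_homogeneousSubmodule k i) n x hx) = aeval a x := by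
  simpa [ha] using awayEval_mk_mul_pow (homogeneousSubmodule σ k) _ (isUnit_aeval_X k ha)
    (isHomogeneous_X _ _) hx

theorem projectivePoint_hom (a : σ → K) {i : σ} (ha : a i = 1) :
    projectivePoint k a ha ≫ (projectiveSpace σ k).hom =
      Spec.map (CommRingCat.ofHom (algebraMap k K)) := by
  simp only [projectivePoint, projectiveSpace, Over.mk_hom, Category.assoc]
  rw [Proj.awayι_toSpecZero_assoc, ← Spec.map_comp, ← Spec.map_comp]
  congr 1
  ext c
  exact (awayEval_aeval_mk ha (n := 0) (isHomogeneous_C _ c)).trans (aeval_C a c)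

theorem aeval_mem_fieldRange_of_specMap_eq_projectivePoint {H : Scheme.{u}} [IsIntegral H]
    {a : σ → K} {i : σ} {ha : a i = 1} {h : H ⟶ (projectiveSpace σ k).left}
    {ι : H.functionField ⟶ .of K}
    (hι : Spec.map ι ≫ fromSpecFunctionField H ≫ h = projectivePoint k a ha) {n : ℕ}
    {x : MvPolynomial σ k} (hx : x.IsHomogeneous n) : aeval a x ∈ ι.hom.fieldRange := by
  obtain ⟨χ, hχ⟩ := exists_comp_eq_of_isOpenImmersion (P := Proj (homogeneousSubmodule σ k)) h ι
    (Proj.awayι (homogeneousSubmodule σ k) (X i) (X_mem_homogeneousSubmodule k i) one_pos) _ hι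
  have hx' : x ∈ homogeneousSubmodule σ k (n • 1) := by simpa using hx
  exact ⟨χ (.mk _ (X_mem_homogeneousSubmodule k i) n x hx'),
    congr($hχ _).trans (awayEval_aeval_mk ha hx')⟩

theorem exists_isProper_of_essFiniteType (k K : Type u) [Field k] [Field K] [Algebra k K]
    [Algebra.EssFiniteType k K] :
    ∃ (H : Over (Spec (.of k))) (_ : IsIntegral H.left) (ι : H.left.functionField ⟶ .of K),
      IsProper H.hom ∧ Function.Bijective ι.hom ∧
      Spec.map ι ≫ fromSpecFunctionField H.left ≫ H.hom =
        Spec.map (CommRingCat.ofHom (algebraMap k K)) := by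
  obtain ⟨S, hS⟩ := IntermediateField.fg_top k K
  let a : Option S → K := fun o ↦ o.elim 1 Subtype.val
  let f := projectivePoint k a (i := none) rfl
  have hproper : IsProper (projectiveSpace (Option S) k).hom := isProper_projectiveSpace
  have hint : IsIntegral f.image := isIntegral_image f
  obtain ⟨ι, hι⟩ := exists_specMap_comp_fromSpecFunctionField_eq f.toImage
  have hιf : Spec.map ι ≫ fromSpecFunctionField f.image ≫ f.imageι = f := by
    rw [reassoc_of% hι, f.toImage_imageι]
  refine ⟨Over.mk (f.imageι ≫ (projectiveSpace (Option S) k).hom), hint, ι,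
    inferInstanceAs (IsProper (f.imageι ≫ (projectiveSpace (Option S) k).hom)),
    ⟨ι.hom.injective, ?_⟩, ?_⟩
  · let F : IntermediateField k K := ι.hom.fieldRange.toIntermediateField fun c ↦ by
      simpa using aeval_mem_fieldRange_of_specMap_eq_projectivePoint hιf (isHomogeneous_C _ c)
    have hF : F = ⊤ := by
      rw [eq_top_iff, ← hS, IntermediateField.adjoin_le_iff]
      intro s hs
      have hs := aeval_mem_fieldRange_of_specMap_eq_projectivePoint hιf
        (isHomogeneous_X k (some (⟨s, hs⟩ : S)))
      rwa [aeval_X] at hs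
    exact fun y ↦ (hF ▸ IntermediateField.mem_top : y ∈ F)
  · exact (congr($hιf ≫ (projectiveSpace (Option S) k).hom)).trans (projectivePoint_hom a rfl)

end ProjectiveSpace

section StructureMap

/-- The structure map `R → K(X)` of the function field of an integral scheme `X` over `R`. -/
noncomputable def functionFieldScalars {R : CommRingCat.{u}} {X : Scheme.{u}} [IsIntegral X]
    (f : X ⟶ Spec R) : R ⟶ X.functionField :=
  Spec.preimage (fromSpecFunctionField X ≫ f)

theorem specMap_functionFieldScalars {R : CommRingCat.{u}} {X : Scheme.{u}} [IsIntegral X]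
    (f : X ⟶ Spec R) : Spec.map (functionFieldScalars f) = fromSpecFunctionField X ≫ f :=
  Spec.map_preimage _

theorem functionFieldScalars_comp_functionFieldMap {R : CommRingCat.{u}} {X Y : Over (Spec R)}
    [IsIntegral X.left] [IsIntegral Y.left] (f : X ⟶ Y) [IsDominant f.left] :
    functionFieldScalars Y.hom ≫ functionFieldMap f.left = functionFieldScalars X.hom := by
  apply Spec.map_injective
  rw [Spec.map_comp, specMap_functionFieldScalars, specMap_functionFieldScalars,
    reassoc_of% specMap_functionFieldMap f.left, Over.w]

theorem essFiniteType_functionFieldScalars {R : CommRingCat.{u}} {X : Scheme.{u}} [IsIntegral X]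
    (f : X ⟶ Spec R) [LocallyOfFiniteType f] : (functionFieldScalars f).hom.EssFiniteType := by
  obtain ⟨U, hU, hηU, -⟩ :=
    exists_isAffineOpen_mem_and_subset (x := genericPoint X) (U := ⊤) trivial
  have : Nonempty U := ⟨⟨_, hηU⟩⟩
  have hφ : LocallyOfFiniteType (Spec.map (Spec.preimage (hU.fromSpec ≫ f))) := by
    rw [Spec.map_preimage]
    infer_instance
  have hfac : functionFieldScalars f =
      Spec.preimage (hU.fromSpec ≫ f) ≫ X.germToFunctionField U := by
    apply Spec.map_injective
    have hη : Spec.map (X.germToFunctionField U) ≫ hU.fromSpec = fromSpecFunctionField X :=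
      hU.fromSpecStalk_eq_fromSpecStalk hηU
    rw [specMap_functionFieldScalars, Spec.map_comp, Spec.map_preimage, reassoc_of% hη]
  have hgerm : (X.germToFunctionField U).hom.EssFiniteType := by
    have := functionField_isFractionRing_of_isAffineOpen X U hU
    exact RingHom.essFiniteType_algebraMap.mpr (.of_isLocalization _ (nonZeroDivisors Γ(X, U)))
  rw [hfac, CommRingCat.hom_comp]
  exact ((HasRingHomProperty.Spec_iff (P := @LocallyOfFiniteType)).mp hφ).essFiniteType.comp hgerm

theorem essFiniteType_of_comp_of_isIntegral {F L K : Type*} [Field F] [Field L] [Field K]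
    {φ : F →+* L} {ψ : L →+* K} (h : (ψ.comp φ).EssFiniteType) (hψ : ψ.IsIntegral) :
    φ.EssFiniteType := by
  algebraize [φ, ψ, ψ.comp φ]
  have : Algebra.IsAlgebraic L K := Algebra.IsIntegral.isAlgebraic
  obtain ⟨s, hs⟩ := exists_isTranscendenceBasis F L
  have hs_finite : s.Finite := finite_of_algebraicIndependent
    (x := fun i : s ↦ algebraMap L K i.1) (K := F)
    (hs.1.map' (f := IsScalarTower.toAlgHom F L K) (algebraMap L K).injective)
  let F' := IntermediateField.adjoin F s
  have : Algebra.IsAlgebraic F' L := by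
    have := hs.isAlgebraic_field
    rwa [Subtype.range_coe] at this
  have : Algebra.IsAlgebraic F' K := .trans _ L K
  have : Algebra.EssFiniteType F' K := .of_comp F _ K
  have : Module.Finite F' K := Algebra.finite_of_essFiniteType_of_isAlgebraic
  have : Module.Finite F' L :=
    .of_injective (IsScalarTower.toAlgHom F' L K).toLinearMap (algebraMap L K).injective
  have : Algebra.EssFiniteType F F' :=
    IntermediateField.essFiniteType_iff.mpr (IntermediateField.fg_adjoin_of_finite hs_finite)
  exact Algebra.EssFiniteType.comp F F' L

end StructureMap

section Model

variable {k : Type u} [Field k]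

theorem exists_isProper_fieldRange_eq {X : Over (Spec (.of k))} [IsIntegral X.left]
    [LocallyOfFiniteType X.hom] {L : Subfield X.left.functionField}
    (hL : (functionFieldScalars X.hom).hom.fieldRange ≤ L) (hint : L.subtype.IsIntegral) :
    ∃ (H : Over (Spec (.of k))) (_ : IsIntegral H.left)
      (ι : H.left.functionField ⟶ X.left.functionField), IsProper H.hom ∧ ι.hom.fieldRange = L ∧
      functionFieldScalars H.hom ≫ ι = functionFieldScalars X.hom := by
  let φ : k →+* L := (functionFieldScalars X.hom).hom.codRestrict L fun c ↦ hL ⟨c, rfl⟩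
  let _ : Algebra k L := φ.toAlgebra
  have : Algebra.EssFiniteType k L := RingHom.essFiniteType_algebraMap.mp
    (essFiniteType_of_comp_of_isIntegral (essFiniteType_functionFieldScalars X.hom) hint)
  obtain ⟨H, hH, ι, hproper, hι, hιk⟩ := exists_isProper_of_essFiniteType k L
  refine ⟨H, hH, ι ≫ CommRingCat.ofHom L.subtype, hproper, ?_, ?_⟩
  · ext f
    exact ⟨fun ⟨g, hg⟩ ↦ hg ▸ (ι.hom g).2, fun hf ↦
      (hι.surjective ⟨f, hf⟩).imp fun g hg ↦ congrArg Subtype.val hg⟩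
  · have hιφ : functionFieldScalars H.hom ≫ ι = CommRingCat.ofHom φ := by
      apply Spec.map_injective
      rw [Spec.map_comp, specMap_functionFieldScalars, hιk]
    exact congr($hιφ ≫ CommRingCat.ofHom L.subtype)

theorem exists_isProper_fieldRange_eq_invariantSubfield {X : Over (Spec (.of k))}
    [IsIntegral X.left] [IsSeparated X.hom] [LocallyOfFiniteType X.hom] (Γ : Subgroup (Aut X))
    [Finite Γ] :
    ∃ (H : Over (Spec (.of k))) (_ : IsIntegral H.left)
      (ι : H.left.functionField ⟶ X.left.functionField),
      IsProper H.hom ∧ ι.hom.fieldRange = invariantSubfield Γ ∧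
      functionFieldScalars H.hom ≫ ι = functionFieldScalars X.hom := by
  refine exists_isProper_fieldRange_eq ?_ (finiteOfDegree_invariantSubfield_subtype Γ).isIntegral
  rintro _ ⟨c, rfl⟩
  exact mem_invariantSubfield.mpr fun γ _ ↦
    congr($(functionFieldScalars_comp_functionFieldMap γ.hom) c)

theorem exists_functionFieldMap_comp_eq {R : CommRingCat.{u}} {X Y H : Over (Spec R)}
    [IsIntegral X.left] [IsIntegral Y.left] [IsIntegral H.left] [IsProper H.hom]
    (π : X ⟶ Y) [IsDominant π.left] (hY : ∀ y : Y.left, ValuationRing (Y.left.presheaf.stalk y))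
    {ι : H.left.functionField ⟶ X.left.functionField}
    (hι : ι.hom.fieldRange ≤ (functionFieldMap π.left).hom.fieldRange)
    (hιR : functionFieldScalars H.hom ≫ ι = functionFieldScalars X.hom) :
    ∃ (u : Y ⟶ H) (_ : IsDominant u.left),
      functionFieldMap u.left ≫ functionFieldMap π.left = ι := by
  obtain ⟨χ, hχ⟩ := exists_comp_eq_of_range_subset (functionFieldMap π.left).hom.injective hι
  obtain ⟨l, hl⟩ : ∃ l : H.left.functionField ⟶ Y.left.functionField,
      l ≫ functionFieldMap π.left = ι := ⟨CommRingCat.ofHom χ, CommRingCat.hom_ext hχ⟩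
  have : Mono (functionFieldMap π.left) :=
    ConcreteCategory.mono_of_injective _ (functionFieldMap π.left).hom.injective
  have hlR : functionFieldScalars H.hom ≫ l = functionFieldScalars Y.hom := by
    rw [← cancel_mono (functionFieldMap π.left), Category.assoc, hl, hιR,
      functionFieldScalars_comp_functionFieldMap π]
  obtain ⟨u, hu, hul⟩ := exists_extension_of_valuationRing_stalk Y.hom H.hom hY
    (Spec.map l ≫ fromSpecFunctionField H.left) <| by
      rw [Category.assoc, ← specMap_functionFieldScalars, ← Spec.map_comp, hlR,
        specMap_functionFieldScalars]
  have : Surjective (Spec.map l) := ⟨Function.surjective_to_subsingleton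
    (α := PrimeSpectrum Y.left.functionField) (β := PrimeSpectrum H.left.functionField) _⟩
  have : IsDominant (fromSpecFunctionField Y.left ≫ u) := by rw [hul]; infer_instance
  have hdom : IsDominant u := .of_comp (fromSpecFunctionField Y.left) u
  have hul' : functionFieldMap u = l := (functionFieldMap_eq_iff u l).mpr hul.symm
  exact ⟨Over.homMk u hu, hdom, congr($hul' ≫ functionFieldMap π.left).trans hl⟩

end Model

section Quotient

theorem IsComplexCurve.of_isIntegral_functionFieldMap {X Y : Over SpecC} (hX : IsComplexCurve X)
    [IsIntegral X.left] [IsIntegral Y.left] [IsProper Y.hom] (f : X ⟶ Y) [IsDominant f.left]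
    (hf : (functionFieldMap f.left).hom.IsIntegral) : IsComplexCurve Y := by
  have : IsProper (f.left ≫ Y.hom) := by rw [Over.w]; exact hX.proper
  have : IsProper f.left := .of_comp _ Y.hom
  exact ⟨‹_›, ‹_›, topologicalKrullDim_eq_one_of_isProper f.left hf hX.dim_eq_one⟩

theorem IsQuotientByGroup.exists_hasDegree {D B H : Over SpecC} [IsIntegral D.left]
    [IsSeparated D.hom] [IsIntegral H.left] [IsProper H.hom]
    (hD : ∀ x : D.left, ValuationRing (D.left.presheaf.stalk x)) {Γ₁ Γ : Subgroup (Aut D)}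
    [Finite Γ₁] [Finite Γ] (hΓ : Γ₁ ≤ Γ) {π : D ⟶ B} (hπ : IsQuotientByGroup Γ₁ π)
    {ι : H.left.functionField ⟶ D.left.functionField} (hι : ι.hom.fieldRange = invariantSubfield Γ)
    (hιk : functionFieldScalars H.hom ≫ ι = functionFieldScalars D.hom) {m : ℕ}
    (hm : Nat.card Γ = m * Nat.card Γ₁) :
    ∃ (u : B ⟶ H) (_ : IsDominant (π ≫ u).left),
      HasDegree u.left m ∧ functionFieldMap (π ≫ u).left = ι := by
  have := hπ.isIntegral_left
  have := hπ.surjective_left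
  obtain ⟨u, _, hu⟩ := exists_functionFieldMap_comp_eq π (hπ.valuationRing_stalk hD)
    (by rw [hι, hπ.fieldRange_functionFieldMap]; exact invariantSubfield_antitone hΓ) hιk
  have hdeg : FiniteOfDegree ι.hom (m * Nat.card Γ₁) :=
    hm ▸ .of_fieldRange_eq hι (finiteOfDegree_invariantSubfield_subtype Γ)
  rw [← hu] at hdeg
  exact ⟨u, inferInstanceAs (IsDominant (π.left ≫ u.left)),
    (hasDegree_iff u.left m).mpr (hdeg.of_comp hπ.finiteOfDegree),
    (functionFieldMap_comp π.left u.left).trans hu⟩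

theorem diagramCompletes_of_card_sup {D B C : Over SpecC} (hD : IsComplexCurve D)
    [Smooth D.hom] {Γ₁ Γ₂ : Subgroup (Aut D)} [Finite ↥(Γ₁ ⊔ Γ₂)] {p : D ⟶ B} {q : D ⟶ C}
    (hp : IsQuotientByGroup Γ₁ p) (hq : IsQuotientByGroup Γ₂ q)
    (h : Nat.card ↥(Γ₁ ⊔ Γ₂) = Nat.card Γ₁ * Nat.card Γ₂) :
    DiagramCompletes p q (Nat.card Γ₂) (Nat.card Γ₁) := by
  have := hD.integral
  have := hD.proper
  have : Finite Γ₁ := .of_injective _ (Subgroup.inclusion_injective (le_sup_left : Γ₁ ≤ Γ₁ ⊔ Γ₂))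
  have : Finite Γ₂ := .of_injective _ (Subgroup.inclusion_injective (le_sup_right : Γ₂ ≤ Γ₁ ⊔ Γ₂))
  have hval := valuationRing_stalk_of_smooth D.hom hD.dim_eq_one.le
  obtain ⟨H, _, ι, _, hι, hιk⟩ := exists_isProper_fieldRange_eq_invariantSubfield (Γ₁ ⊔ Γ₂)
  obtain ⟨u, _, hu, hpu⟩ :=
    hp.exists_hasDegree hval le_sup_left hι hιk (h.trans (mul_comm _ _))
  obtain ⟨v, _, hv, hqv⟩ := hq.exists_hasDegree hval le_sup_right hι hιk h
  have huv : p ≫ u = q ≫ v := Over.OverMorphism.ext <|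
    eq_of_functionFieldMap_eq H.hom (by rw [Over.w, Over.w]) (hpu.trans hqv.symm)
  have hint : (functionFieldMap (p ≫ u).left).hom.IsIntegral :=
    hpu ▸ FiniteOfDegree.isIntegral
      (.of_fieldRange_eq hι (finiteOfDegree_invariantSubfield_subtype _))
  exact ⟨H, u, v, hD.of_isIntegral_functionFieldMap (p ≫ u) hint, hu, hv, huv⟩

theorem card_map_sup_map_zpowers {G A : Type*} [Group G] [Group A] {ρ : G →* A}
    (hρ : Function.Injective ρ) (α β : G) :
    Nat.card ↥((Subgroup.zpowers β).map ρ ⊔ (Subgroup.zpowers α).map ρ) =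
      Nat.card (Subgroup.closure {α, β}) := by
  rw [← Subgroup.map_sup, Subgroup.card_map_of_injective hρ, Set.pair_comm, Set.insert_eq,
    Subgroup.closure_union, Subgroup.zpowers_eq_closure, Subgroup.zpowers_eq_closure]

end Quotient

theorem mainTheorem8_general {D B C : Over SpecC} (hD : IsComplexCurve D) [Smooth D.hom]
    {Γ₁ Γ₂ : Subgroup (Aut D)} [Finite Γ₁] [Finite Γ₂] {p : D ⟶ B} {q : D ⟶ C}
    (hp : IsQuotientByGroup Γ₁ p) (hq : IsQuotientByGroup Γ₂ q) :
    (ENat.card ↥(Γ₁ ⊔ Γ₂) = Nat.card Γ₁ * Nat.card Γ₂ →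
      DiagramCompletes p q (Nat.card Γ₂) (Nat.card Γ₁)) ∧
    (Nat.card Γ₁ * Nat.card Γ₂ < ENat.card ↥(Γ₁ ⊔ Γ₂) →
      ¬ DiagramCompletes p q (Nat.card Γ₂) (Nat.card Γ₁)) := by
  have := hD.integral
  have := hD.proper
  refine ⟨fun h ↦ ?_, fun h hdiag ↦ ?_⟩
  · have : Finite ↥(Γ₁ ⊔ Γ₂) := ENat.card_lt_top.mp <| by
      rw [h, ← Nat.cast_mul]
      exact ENat.natCast_lt_top _
    refine diagramCompletes_of_card_sup hD hp hq ?_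
    rwa [ENat.card_eq_coe_natCard, ← Nat.cast_mul, Nat.cast_inj] at h
  · exact ((hdiag.card_sup_le hp hq).trans_eq (mul_comm _ _)).not_gt h

theorem mainTheorem8 (D : Over SpecC) (hD : IsComplexCurve D) (hDsmooth : Smooth D.hom)
    {G : Type*} [Group G] [Finite G] (ρ : G →* Aut D) (hρ : Function.Injective ρ)
    (α β : G) (d e : ℕ) (hα : orderOf α = d) (hβ : orderOf β = e) (hd : 2 ≤ d) (he : 2 ≤ e)
    (B C : Over SpecC) (p : D ⟶ B) (q : D ⟶ C)
    (hp : IsQuotientByGroup ((Subgroup.zpowers β).map ρ) p)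
    (hq : IsQuotientByGroup ((Subgroup.zpowers α).map ρ) q) :
    (Nat.card (Subgroup.closure {α, β}) = e * d → DiagramCompletes p q d e) ∧
    (e * d < Nat.card (Subgroup.closure {α, β}) → ¬ DiagramCompletes p q d e) := by
  have hcard (g : G) : Nat.card ((Subgroup.zpowers g).map ρ) = orderOf g := by
    rw [Subgroup.card_map_of_injective hρ, Nat.card_zpowers]
  have hfinite (S : Subgroup G) : Finite (S.map ρ) := .of_equiv S (S.equivMapOfInjective ρ hρ)
  have : Finite ↥((Subgroup.zpowers β).map ρ ⊔ (Subgroup.zpowers α).map ρ) := by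
    rw [← Subgroup.map_sup]
    exact hfinite _
  have hmain := mainTheorem8_general hD hp hq
  rw [hcard, hcard, hα, hβ, ENat.card_eq_coe_natCard, card_map_sup_map_zpowers hρ] at hmain
  exact_mod_cast hmain
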